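/- Let $A$ be an artin algebra, that is, an algebra over a commutative artinian ring $R$ that is finitely generated as an $R$-module, and let $\mathrm{mod}\,A$ be the category of finitely generated left $A$-modules. Suppose that $A$ is a Nakayama algebra: every indecomposable projective left $A$-module and every indecomposable projective right $A$-module (finitely generated) is uniserial, i.e. its submodules form a chain. For $X,Y\in\mathrm{mod}\,A$ let $\underline{\mathrm{Hom}}_A(X,Y)$ be the quotient of $\mathrm{Hom}_A(X,Y)$ by the subgroup of the homomorphisms that factor through a projective module in $\mathrm{mod}\,A$; for $X=Y$ it is a ring. For a class $\mathcal C$ of modules let $\langle\mathcal C\rangle$ be the class of the modules that are direct summands of finite direct sums of members of $\mathcal C$. For two classes $\mathcal C,\mathcal D$ let $\mathcal C*\mathcal D$ be the class of the indecomposable modules $Y\in\mathrm{mod}\,A$ for which there is a short exact sequence $$0\longrightarrow X\longrightarrow Y\oplus P\longrightarrow Z\longrightarrow 0$$ in $\mathrm{mod}\,A$ with $P$ projective, $Z\in\langle\mathcal D\rangle$ and $X\in\langle\mathcal C\cup\{\text{projective modules in }\mathrm{mod}\,A\}\rangle$. Put $\langle\mathcal C\rangle_1=\langle\mathcal C\rangle$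 and $\langle\mathcal C\rangle_n=\langle\langle\mathcal C\rangle_{n-1}*\mathcal C\rangle$ for $n\ge 2$. A class $\mathcal S$ of modules in $\mathrm{mod}\,A$ without nonzero projective direct summands is a simple-minded system if 1. $\underline{\mathrm{Hom}}_A(S,T)=0$ for all $S\ne T$ in $\mathcal S$, and $\underline{\mathrm{Hom}}_A(S,S)$ is a division ring for every $S\in\mathcal S$; 2. for every indecomposable non-projective $X\in\mathrm{mod}\,A$ there is an $n\geq 1$ with $X\in\langle\mathcal S\rangle_n$. Let $\mathcal S$ be a simple-minded system over $A$, and let $\mathcal T$ be a complete set of pairwise non-isomorphic non-projective simple $A$-modules. Then $\mathcal S$ is finite and $|\mathcal S|=|\mathcal T|$. Moreover, if $\mathcal S=\{M_1,\dots,M_n\}$ and $\mathcal T=\{S_1,\dots,S_n\}$ with $n=|\mathcal S|$, then there are permutations $\sigma,\rho$ of $\{1,\dots,n\}$ with $\mathrm{top}(M_i)\cong S_{\sigma(i)}$ and $\mathrm{soc}(M_i)\cong S_{\rho(i)}$ for all $i$. -/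

import Mathlib

universe u

namespace SimpleMinded

section Modules

variable (A : Type u) [Ring A]

/-- A module is indecomposable if it is nonzero and is not the direct sum of two nonzero
submodules. -/
def IsIndecomposable (M : Type u) [AddCommGroup M] [Module A M] : Prop :=
  Nontrivial M ∧ ∀ N N' : Submodule A M, IsCompl N N' → N = ⊥ ∨ N' = ⊥

/-- A module is uniserial if its submodules form a chain. -/
def IsUniserial (M : Type u) [AddCommGroup M] [Module A M] : Prop :=
  ∀ N N' : Submodule A M, N ≤ N' ∨ N' ≤ N

/-- Every finitely generated indecomposable projective left module is uniserial. -/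
def HasUniserialProjectives : Prop :=
  ∀ (P : Type u) [AddCommGroup P] [Module A P],
    Module.Finite A P → Module.Projective A P → IsIndecomposable A P → IsUniserial A P

/-- `A` is a Nakayama algebra: the indecomposable projective left modules and the indecomposable
projective right modules (left modules over the opposite ring) are uniserial. That `A` is an artin
algebra is a separate assumption. -/
def IsNakayama : Prop :=
  HasUniserialProjectives A ∧ HasUniserialProjectives Aᵐᵒᵖ

/-- `M` has no nonzero projective direct summand. -/
def HasNoProjectiveSummand (M : Type u) [AddCommGroup M] [Module A M] : Prop :=
  ∀ N N' : Submodule A M, IsCompl N N' → Module.Projective A N → N = ⊥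

/-- The top of a module: its quotient by the radical, which is the intersection of the maximal
submodules. -/
abbrev Top (M : Type u) [AddCommGroup M] [Module A M] : Type u :=
  M ⧸ Module.jacobson A M

/-- The socle of a module: the sum of its simple submodules. -/
def socle (M : Type u) [AddCommGroup M] [Module A M] : Submodule A M :=
  sSup {N : Submodule A M | IsSimpleModule A N}

/-- A homomorphism factors through a finitely generated projective module. -/
def FactorsThroughProjective {X Y : Type u} [AddCommGroup X] [Module A X]
    [AddCommGroup Y] [Module A Y] (f : X →ₗ[A] Y) : Prop :=
  ∃ (P : Type u) (_ : AddCommGroup P) (_ : Module A P),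
    Module.Finite A P ∧ Module.Projective A P ∧
      ∃ (g : X →ₗ[A] P) (h : P →ₗ[A] Y), f = h ∘ₗ g

section

variable {A}
variable {X Y : Type u} [AddCommGroup X] [Module A X] [AddCommGroup Y] [Module A Y]

theorem FactorsThroughProjective.zero :
    FactorsThroughProjective A (0 : X →ₗ[A] Y) :=
  ⟨PUnit, inferInstance, inferInstance, inferInstance, inferInstance, 0, 0, by simp⟩

theorem FactorsThroughProjective.add {f f' : X →ₗ[A] Y}
    (hf : FactorsThroughProjective A f) (hf' : FactorsThroughProjective A f') :
    FactorsThroughProjective A (f + f') := by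
  obtain ⟨P, _, _, hP, hP', g, h, rfl⟩ := hf
  obtain ⟨Q, _, _, hQ, hQ', g', h', rfl⟩ := hf'
  exact ⟨P × Q, inferInstance, inferInstance, inferInstance, inferInstance,
    g.prod g', h.coprod h', by ext; simp⟩

theorem FactorsThroughProjective.neg {f : X →ₗ[A] Y}
    (hf : FactorsThroughProjective A f) : FactorsThroughProjective A (-f) := by
  obtain ⟨P, _, _, hP, hP', g, h, rfl⟩ := hf
  exact ⟨P, inferInstance, inferInstance, hP, hP', g, -h, by ext; simp⟩

end

/-- The subgroup of `Hom(X, Y)` of the homomorphisms that factor through a projective. -/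
def projHoms (X Y : Type u) [AddCommGroup X] [Module A X] [AddCommGroup Y] [Module A Y] :
    AddSubgroup (X →ₗ[A] Y) where
  carrier := {f | FactorsThroughProjective A f}
  zero_mem' := FactorsThroughProjective.zero
  add_mem' := FactorsThroughProjective.add
  neg_mem' := FactorsThroughProjective.neg

/-- The group of morphisms from `X` to `Y` in the stable category. -/
abbrev StableHom (X Y : Type u) [AddCommGroup X] [Module A X] [AddCommGroup Y] [Module A Y] :
    Type u :=
  (X →ₗ[A] Y) ⧸ projHoms A X Y

/-- The two-sided ideal of `End(M)` of the endomorphisms that factor through a projective. -/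
def projEnds (M : Type u) [AddCommGroup M] [Module A M] : TwoSidedIdeal (Module.End A M) :=
  TwoSidedIdeal.mk' {f | FactorsThroughProjective A f}
    FactorsThroughProjective.zero
    FactorsThroughProjective.add
    FactorsThroughProjective.neg
    (by
      rintro e _ ⟨P, _, _, hP, hP', g, h, rfl⟩
      exact ⟨P, inferInstance, inferInstance, hP, hP', g, e ∘ₗ h, rfl⟩)
    (by
      rintro _ e ⟨P, _, _, hP, hP', g, h, rfl⟩
      exact ⟨P, inferInstance, inferInstance, hP, hP', g ∘ₗ e, h, rfl⟩)

/-- The endomorphism ring of `M` in the stable category. -/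
abbrev StableEnd (M : Type u) [AddCommGroup M] [Module A M] : Type u :=
  (projEnds A M).ringCon.Quotient

end Modules

/-- A ring is a division ring: it is nonzero and all its nonzero elements are invertible. -/
def IsDivision (K : Type u) [Ring K] : Prop :=
  Nontrivial K ∧ ∀ x : K, x ≠ 0 → IsUnit x

section Systems

variable {A : Type u} [Ring A]

/-- The class of the modules that are direct summands of finite direct sums of members of `C`:
`X` is a direct summand of a module exactly if it is a retract of it. -/
def addClosure (C : Set (ModuleCat.{u} A)) : Set (ModuleCat.{u} A) :=
  {X | ∃ (n : ℕ) (Y : Fin n → ModuleCat.{u} A), (∀ i, Y i ∈ C) ∧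
    ∃ (s : X →ₗ[A] (∀ i, Y i)) (r : (∀ i, Y i) →ₗ[A] X), r ∘ₗ s = LinearMap.id}

variable (A) in
/-- The class of the finitely generated projective modules. -/
def projectives : Set (ModuleCat.{u} A) :=
  {P | Module.Finite A P ∧ Module.Projective A P}

/-- The class of the finitely generated indecomposable modules `Y` for which there is a short exact
sequence `0 → X → Y ⊕ P → Z → 0` with `P` projective, `Z` a direct summand of a finite direct sum
of members of `D`, and `X` a direct summand of a finite direct sum of members of `C` and of
projective modules. -/
def extensions (C D : Set (ModuleCat.{u} A)) : Set (ModuleCat.{u} A) :=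
  {Y | Module.Finite A Y ∧ IsIndecomposable A Y ∧
    ∃ X ∈ addClosure (C ∪ projectives A), ∃ Z ∈ addClosure D, ∃ P ∈ projectives A,
      ∃ (f : X →ₗ[A] Y × P) (g : Y × P →ₗ[A] Z),
        Function.Injective f ∧ Function.Exact f g ∧ Function.Surjective g}

/-- The classes generated by `C` in finitely many steps. The numbering starts with `0`: the class
that is generated in `n` steps, `n ≥ 1`, is `generated C (n - 1)`. -/
def generated (C : Set (ModuleCat.{u} A)) : ℕ → Set (ModuleCat.{u} A)
  | 0 => addClosure C
  | n + 1 => addClosure (extensions (generated C n) C)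

/-- Simple-minded systems in the category of finitely generated left modules. -/
structure IsSimpleMindedSystem (𝒮 : Set (ModuleCat.{u} A)) : Prop where
  /-- The members are finitely generated. -/
  finite : ∀ M ∈ 𝒮, Module.Finite A M
  /-- The members have no nonzero projective direct summands. -/
  noProjectiveSummand : ∀ M ∈ 𝒮, HasNoProjectiveSummand A M
  /-- Distinct members are orthogonal in the stable category. -/
  orthogonal : ∀ M ∈ 𝒮, ∀ N ∈ 𝒮, M ≠ N → Subsingleton (StableHom A M N)
  /-- The stable endomorphism rings of the members are division rings. -/
  division : ∀ M ∈ 𝒮, IsDivision (StableEnd A M)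
  /-- Every finitely generated indecomposable non-projective module is generated by the system. -/
  generating : ∀ X : ModuleCat.{u} A, Module.Finite A X → IsIndecomposable A X →
    ¬ Module.Projective A X → ∃ n, X ∈ generated 𝒮 n

/-- `𝒯` is a complete set of pairwise non-isomorphic non-projective simple modules. -/
structure IsCompleteSetOfNonprojectiveSimples (𝒯 : Set (ModuleCat.{u} A)) : Prop where
  simple : ∀ S ∈ 𝒯, IsSimpleModule A S
  nonprojective : ∀ S ∈ 𝒯, ¬ Module.Projective A S
  nonisomorphic : ∀ S ∈ 𝒯, ∀ T ∈ 𝒯, Nonempty (S ≃ₗ[A] T) → S = T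
  complete : ∀ S : ModuleCat.{u} A, IsSimpleModule A S → ¬ Module.Projective A S →
    ∃ T ∈ 𝒯, Nonempty (S ≃ₗ[A] T)

end Systems

end SimpleMinded

/-! The proof bounds the size of `𝒮` from both sides, by tops and by socles. Over an artinian
Nakayama ring every finitely generated indecomposable module is a quotient of some `Ae` with `e` a
primitive idempotent, hence uniserial. The members of `𝒮` are indecomposable and not projective, so
their tops and socles are simple, and these turn out to be non-projective too. Taking tops and
socles thus gives two maps from `𝒮` to `𝒯`.

The top map is injective. Two members with isomorphic tops are quotients of the same uniserial `Ae`,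
so one of them surjects onto the other. Such a surjection is nonzero in the stable category
(`IsIndecomposable.not_factors_of_surjective`), which contradicts orthogonality unless the members
coincide.

The socle map is surjective. If all homomorphisms from a simple `T` to members of `𝒮` were stably
zero, this would propagate through extensions and summands to everything that `𝒮` generates. The
identity of a non-projective `T` would then be stably zero, which is absurd. So some `T → M` is
nonzero, and its image is the socle of the uniserial module `M`.

Since `𝒯` is finite, both maps are bijections. The main technical step is
`exists_isCompl_span_of_length_max`, from which uniseriality follows. -/

namespace SimpleMinded

/-! ### Primitive idempotents and the radical -/

section PrimitiveIdempotents

/-- An idempotent is primitive if it is nonzero and has no proper nonzero subidempotents. -/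
def IsPrimitiveIdempotent {A : Type*} [Ring A] (e : A) : Prop :=
  IsIdempotentElem e ∧ e ≠ 0 ∧
    ∀ f : A, IsIdempotentElem f → e * f = f → f * e = f → f = 0 ∨ f = e

variable {A : Type u} [Ring A]

theorem IsPrimitiveIdempotent.op {e : A} (he : IsPrimitiveIdempotent e) :
    IsPrimitiveIdempotent (MulOpposite.op e) := by
  obtain ⟨h1, h2, h3⟩ := he
  refine ⟨congrArg MulOpposite.op h1, by simpa using h2, fun f hf hef hfe => ?_⟩
  have := h3 f.unop (congrArg MulOpposite.unop hf) (congrArg MulOpposite.unop hfe)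
    (congrArg MulOpposite.unop hef)
  rcases this with h | h
  · left; exact MulOpposite.unop_injective (by simpa using h)
  · right; exact MulOpposite.unop_injective (by simpa using h)

theorem mem_span_singleton_idempotent {e a : A} (he : IsIdempotentElem e) :
    a ∈ Submodule.span A {e} ↔ a * e = a := by
  rw [Submodule.mem_span_singleton]
  constructor
  · rintro ⟨b, rfl⟩
    simp [mul_assoc, he.eq]
  · intro h
    exact ⟨a, h⟩

theorem span_singleton_idempotent_projective {e : A} (he : IsIdempotentElem e) :
    Module.Projective A (Submodule.span A {e}) := by
  refine Module.Projective.of_split (Submodule.span A {e}).subtype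
    ((LinearMap.toSpanSingleton A A e).codRestrict _ fun a =>
      Submodule.mem_span_singleton.2 ⟨a, rfl⟩) ?_
  ext ⟨a, ha⟩
  simpa using (mem_span_singleton_idempotent he).1 ha

theorem IsPrimitiveIdempotent.isIndecomposable {e : A} (he : IsPrimitiveIdempotent e) :
    IsIndecomposable A (Submodule.span A {e}) := by
  obtain ⟨h1, h2, h3⟩ := he
  refine ⟨⟨⟨e, Submodule.mem_span_singleton_self e⟩, 0, fun h => h2 (congrArg Subtype.val h)⟩, ?_⟩
  intro N N' hN
  have htop : (⟨e, Submodule.mem_span_singleton_self e⟩ : Submodule.span A {e}) ∈ N ⊔ N' := by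
    rw [hN.sup_eq_top]; trivial
  obtain ⟨n, hn, n', hn', hsum⟩ := Submodule.mem_sup.1 htop
  have hs : (n : A) + n' = e := congrArg Subtype.val hsum
  -- The components of `m` in `N` and `N'` are therefore `m • n` and `m • n'`. Uniqueness of
  -- components makes `n` an idempotent below `e`.
  have key : ∀ m : Submodule.span A {e}, (m : A) • n + (m : A) • n' = m := by
    intro m
    apply Subtype.ext
    have := (mem_span_singleton_idempotent h1).1 m.2
    simp only [Submodule.coe_add, Submodule.coe_smul, smul_eq_mul, ← mul_add, hs, this]
  have uniq : ∀ p ∈ N, ∀ p' ∈ N', ∀ q ∈ N, ∀ q' ∈ N', p + p' = q + q' → p = q ∧ p' = q' := by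
    intro p hp p' hp' q hq q' hq' h
    have h' : p - q = q' - p' := by rw [sub_eq_sub_iff_add_eq_add, h, add_comm]
    have hz := Submodule.disjoint_def.1 hN.disjoint _ (N.sub_mem hp hq)
      (h' ▸ N'.sub_mem hq' hp')
    refine ⟨sub_eq_zero.1 hz, ?_⟩
    rw [hz] at h'
    exact (sub_eq_zero.1 h'.symm).symm
  have hnn := uniq _ (N.smul_mem (n : A) hn) _ (N'.smul_mem (n : A) hn') _ hn _ N'.zero_mem
    (by rw [key, add_zero])
  have hen := uniq _ (N.smul_mem e hn) _ (N'.smul_mem e hn') _ hn _ hn'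
    (by rw [key ⟨e, _⟩, hsum])
  rcases h3 n (congrArg Subtype.val hnn.1) (congrArg Subtype.val hen.1)
    ((mem_span_singleton_idempotent h1).1 n.2) with h | h
  · left
    rw [eq_bot_iff]
    intro m hm
    have := uniq _ (N.smul_mem (m : A) hn) _ (N'.smul_mem (m : A) hn') _ hm _ N'.zero_mem
      (by rw [key, add_zero])
    rw [Submodule.mem_bot, ← this.1, show n = 0 from Subtype.ext h, smul_zero]
  · right
    have hn0 : n' = 0 := by
      apply Subtype.ext
      rw [h] at hs
      simpa using hs
    rw [eq_bot_iff]
    intro m hm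
    have := uniq _ (N.smul_mem (m : A) hn) _ (N'.smul_mem (m : A) hn') _ N.zero_mem _ hm
      (by rw [key, zero_add])
    rw [Submodule.mem_bot, ← this.2, hn0, smul_zero]

/-- An idempotent `e` that is neither zero nor primitive splits as `f + (e - f)`, and both parts
generate strictly smaller left ideals. This weak form of a decomposition of `1` suffices for testing
membership on primitive idempotents. -/
theorem one_mem_span_primitive [IsArtinianRing A] :
    (1 : A) ∈ Submodule.span A {e : A | IsPrimitiveIdempotent e} := by
  suffices h : ∀ N : Submodule A A, ∀ e : A, IsIdempotentElem e → Submodule.span A {e} = N →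
      e ∈ Submodule.span A {e : A | IsPrimitiveIdempotent e} from
    h _ 1 IsIdempotentElem.one rfl
  intro N
  induction N using WellFoundedLT.induction with
  | ind N ih =>
    rintro e he rfl
    by_cases hp : IsPrimitiveIdempotent e
    · exact Submodule.subset_span hp
    by_cases h0 : e = 0
    · rw [h0]; exact Submodule.zero_mem _
    simp only [IsPrimitiveIdempotent, not_and, not_forall, not_or] at hp
    obtain ⟨f, hf, hef, hfe, hf0, hfe'⟩ := hp he h0
    have lt : ∀ f : A, IsIdempotentElem f → e * f = f → f * e = f → f ≠ e →
        Submodule.span A {f} < Submodule.span A {e} := by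
      intro f hf hef hfe hne
      refine lt_of_le_of_ne ?_ fun h => hne ?_
      · rw [Submodule.span_singleton_le_iff_mem, mem_span_singleton_idempotent he]
        exact hfe
      · have : e ∈ Submodule.span A {f} := h ▸ Submodule.mem_span_singleton_self e
        rw [mem_span_singleton_idempotent hf, hef] at this
        exact this
    have hg : IsIdempotentElem (e - f) := by
      simp only [IsIdempotentElem, mul_sub, sub_mul, he.eq, hf.eq, hef, hfe, sub_self, sub_zero]
    have := Submodule.add_mem _ (ih _ (lt f hf hef hfe hfe') f hf rfl)
      (ih _ (lt (e - f) hg (by rw [mul_sub, he.eq, hef]) (by rw [sub_mul, he.eq, hfe])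
        (by simpa using hf0)) _ hg rfl)
    simpa using this

theorem mem_of_primitive_smul_mem [IsArtinianRing A] {M : Type*} [AddCommGroup M] [Module A M]
    (N : Submodule A M) (m : M) (h : ∀ g : A, IsPrimitiveIdempotent g → g • m ∈ N) : m ∈ N := by
  have : Submodule.span A {e : A | IsPrimitiveIdempotent e} ≤
      N.comap (LinearMap.toSpanSingleton A M m) := Submodule.span_le.2 fun g hg => h g hg
  simpa using this one_mem_span_primitive

theorem left_chain (hA : HasUniserialProjectives A) {e : A} (he : IsPrimitiveIdempotent e)
    {a b : A} (ha : a * e = a) (hb : b * e = b) : (∃ r, a = r * b) ∨ ∃ r, b = r * a := by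
  have hproj := span_singleton_idempotent_projective he.1
  have hfin : Module.Finite A (Submodule.span A {e}) := inferInstance
  let a' : Submodule.span A {e} := ⟨a, (mem_span_singleton_idempotent he.1).2 ha⟩
  let b' : Submodule.span A {e} := ⟨b, (mem_span_singleton_idempotent he.1).2 hb⟩
  rcases hA _ hfin hproj he.isIndecomposable (Submodule.span A {a'}) (Submodule.span A {b'})
    with h | h
  · left
    obtain ⟨r, hr⟩ := Submodule.mem_span_singleton.1 (h (Submodule.mem_span_singleton_self a'))
    exact ⟨r, (congrArg Subtype.val hr).symm⟩
  · right
    obtain ⟨r, hr⟩ := Submodule.mem_span_singleton.1 (h (Submodule.mem_span_singleton_self b'))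
    exact ⟨r, (congrArg Subtype.val hr).symm⟩

theorem right_chain (hA : HasUniserialProjectives Aᵐᵒᵖ) {e : A} (he : IsPrimitiveIdempotent e)
    {a b : A} (ha : e * a = a) (hb : e * b = b) : (∃ r, a = b * r) ∨ ∃ r, b = a * r := by
  rcases left_chain hA he.op (congrArg MulOpposite.op ha) (congrArg MulOpposite.op hb)
    with ⟨r, hr⟩ | ⟨r, hr⟩
  · exact Or.inl ⟨r.unop, congrArg MulOpposite.unop hr⟩
  · exact Or.inr ⟨r.unop, congrArg MulOpposite.unop hr⟩

theorem smul_eq_zero_of_mem_jacobson {M : Type*} [AddCommGroup M] [Module A M] {j : A}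
    (hj : j ∈ Ring.jacobson A) {y : M} (h : j • y = y) : y = 0 := by
  rw [← Ideal.jacobson_bot, Ideal.mem_jacobson_iff] at hj
  obtain ⟨z, hz⟩ := hj (-1)
  have hz' : z - z * j = 1 := by
    rw [Ideal.mem_bot] at hz
    rw [← sub_eq_zero, ← hz]; noncomm_ring
  calc y = (z - z * j) • y := by rw [hz', one_smul]
    _ = 0 := by rw [sub_smul, mul_smul, h, sub_self]

/-- The non-generators of the uniserial module `Ae` lie in its radical. For every `y`, `e + eya`
still generates `a`, because otherwise `e` would be a multiple of `a`. From this a left inverse of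
`1 + ya` can be written down. -/
theorem mem_jacobson_of_not_generator (hA : HasUniserialProjectives A) {e : A}
    (he : IsPrimitiveIdempotent e) {a : A} (ha : a * e = a) (h : ¬ ∃ s, s * a = e) :
    a ∈ Ring.jacobson A := by
  rw [← Ideal.jacobson_bot, Ideal.mem_jacobson_iff]
  intro y
  set u := e + e * (y * a) with hu
  have hue : u * e = u := by rw [hu, add_mul, mul_assoc, mul_assoc, ha, he.1.eq]
  obtain ⟨s, hs⟩ : ∃ s, a = s * u := by
    rcases left_chain hA he ha hue with hs | ⟨s, hs⟩
    · exact hs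
    · exact absurd ⟨s - e * y, by rw [sub_mul, ← hs, hu]; noncomm_ring⟩ h
  refine ⟨1 - y * s * e, ?_⟩
  have h1 : s * u = s * e * (1 + y * a) := by rw [hu]; noncomm_ring
  have h2 : (1 - y * s * e) * (1 + y * a) = 1 := by
    calc (1 - y * s * e) * (1 + y * a) = 1 + y * a - y * (s * e * (1 + y * a)) := by noncomm_ring
      _ = 1 := by rw [← h1, ← hs]; noncomm_ring
  rw [Ideal.mem_bot, sub_eq_zero]
  refine Eq.trans ?_ h2
  noncomm_ring

/-- With `J` the radical, `Jf` is principal: the chain condition in `Af` makes a maximal `Ac`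
swallow every `hj` with `h` primitive. The condition `g * c = c` later places `c` in the right chain
`gA`. -/
theorem exists_generator_jacobson_mul [IsArtinianRing A] (hA : HasUniserialProjectives A) {f : A}
    (hf : IsPrimitiveIdempotent f) :
    ∃ g c : A, IsPrimitiveIdempotent g ∧ g * c = c ∧ c * f = c ∧ c ∈ Ring.jacobson A ∧
      ∀ j ∈ Ring.jacobson A, j * f = j → ∃ a, j = a * c := by
  obtain ⟨_, ⟨g, c, hg, hgc, hcf, hcJ, rfl⟩, hmax⟩ := (wellFounded_gt (α := Submodule A A)).has_min
    {N | ∃ g c : A, IsPrimitiveIdempotent g ∧ g * c = c ∧ c * f = c ∧ c ∈ Ring.jacobson A ∧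
      Submodule.span A {c} = N} ⟨_, f, 0, hf, by simp, by simp, Submodule.zero_mem _, rfl⟩
  refine ⟨g, c, hg, hgc, hcf, hcJ, fun j hj hjf => ?_⟩
  suffices j ∈ Submodule.span A {c} by
    obtain ⟨a, ha⟩ := Submodule.mem_span_singleton.1 this
    exact ⟨a, ha.symm⟩
  apply mem_of_primitive_smul_mem
  intro h hh
  have hhf : h * j * f = h * j := by rw [mul_assoc, hjf]
  rw [smul_eq_mul]
  rcases left_chain hA hf hhf hcf with ⟨r, hr⟩ | ⟨r, hr⟩
  · exact Submodule.mem_span_singleton.2 ⟨r, hr.symm⟩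
  · have hle : Submodule.span A {c} ≤ Submodule.span A {h * j} :=
      (Submodule.span_singleton_le_iff_mem _ _).2 (Submodule.mem_span_singleton.2 ⟨r, hr.symm⟩)
    have := hmax _ ⟨h, h * j, hh, by rw [← mul_assoc, hh.1.eq], hhf,
      Submodule.smul_mem _ h hj, rfl⟩
    rw [eq_of_le_of_not_lt hle this]
    exact Submodule.mem_span_singleton_self _

end PrimitiveIdempotents

end SimpleMinded

namespace SimpleMinded

/-! ### Splitting off a longest local submodule -/

section Uniserial

variable {A : Type u} [Ring A]

theorem exists_primitive_smul_eq_of_not_mem [IsArtinianRing A] {M : Type*} [AddCommGroup M]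
    [Module A M] {W : Submodule A M} {m : M} (h : m ∉ W) :
    ∃ g : A, IsPrimitiveIdempotent g ∧ g • m ∉ W ∧ g • (g • m) = g • m := by
  by_contra hc
  push Not at hc
  refine h (mem_of_primitive_smul_mem W m fun g hg => ?_)
  by_contra hgm
  exact hc g hg hgm (by rw [← mul_smul, hg.1.eq])

/-- Take `Ay` minimal among the local submodules not inside `W`. If `j • y ∉ W`, minimality would
give `y = (ahj) • y` with `ahj` in the radical, hence `y = 0`. -/
theorem exists_primitive_minimal_over [IsArtinianRing A] {M : Type*} [AddCommGroup M]
    [Module A M] [IsArtinian A M] {W : Submodule A M} (hW : W ≠ ⊤) :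
    ∃ (f : A) (y : M), IsPrimitiveIdempotent f ∧ f • y = y ∧ y ∉ W ∧
      ∀ j ∈ Ring.jacobson A, j • y ∈ W := by
  obtain ⟨m, hm⟩ : ∃ m, m ∉ W := by
    by_contra hc
    push Not at hc
    exact hW (eq_top_iff.2 fun m _ => hc m)
  obtain ⟨g, hg, hgm, hggm⟩ := exists_primitive_smul_eq_of_not_mem hm
  obtain ⟨_, ⟨f, y, hf, hfy, hyW, rfl⟩, hmin⟩ := (wellFounded_lt (α := Submodule A M)).has_min
    {N | ∃ (f : A) (y : M), IsPrimitiveIdempotent f ∧ f • y = y ∧ y ∉ W ∧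
      Submodule.span A {y} = N} ⟨_, g, g • m, hg, hggm, hgm, rfl⟩
  refine ⟨f, y, hf, hfy, hyW, fun j hj => ?_⟩
  by_contra hjy
  obtain ⟨h, hh, hhj, hhhj⟩ := exists_primitive_smul_eq_of_not_mem hjy
  have hle : Submodule.span A {h • j • y} ≤ Submodule.span A {y} := by
    rw [Submodule.span_singleton_le_iff_mem]
    exact Submodule.smul_mem _ _ (Submodule.smul_mem _ _ (Submodule.mem_span_singleton_self y))
  have heq := eq_of_le_of_not_lt hle (hmin _ ⟨h, _, hh, hhhj, hhj, rfl⟩)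
  obtain ⟨a, ha⟩ := Submodule.mem_span_singleton.1
    (heq ▸ Submodule.mem_span_singleton_self y : y ∈ Submodule.span A {h • j • y})
  rw [← mul_smul, ← mul_smul] at ha
  exact hyW (smul_eq_zero_of_mem_jacobson (Submodule.smul_mem _ (a * h) hj) ha ▸ W.zero_mem)

/-- Modulo `N` the module `Ax` keeps its length, and its image lies strictly inside that of `Ay`. -/
theorem length_span_singleton_lt [IsArtinianRing A] {M : Type*} [AddCommGroup M]
    [Module A M] [Module.Finite A M] {N : Submodule A M} {x y : M}
    (hN : Disjoint (Submodule.span A {x}) N) (hy : y ∉ Submodule.span A {x} ⊔ N)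
    {n : M} (hn : n ∈ N) (hx : x + n ∈ Submodule.span A {y}) :
    Module.length A (Submodule.span A {x}) < Module.length A (Submodule.span A {y}) := by
  have hlt : (Submodule.span A {x}).map N.mkQ < (Submodule.span A {y}).map N.mkQ := by
    refine lt_of_le_of_ne ?_ fun h => hy ?_
    · rw [Submodule.map_span, Set.image_singleton, Submodule.span_singleton_le_iff_mem]
      refine ⟨_, hx, ?_⟩
      rw [map_add, Submodule.mkQ_apply N n, (Submodule.Quotient.mk_eq_zero N).2 hn, add_zero]
    · have : N.mkQ y ∈ (Submodule.span A {x}).map N.mkQ :=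
        h ▸ Submodule.mem_map_of_mem (Submodule.mem_span_singleton_self y)
      obtain ⟨z, hz, hzy⟩ := this
      have hyz : y - z ∈ N := by
        rw [← Submodule.Quotient.mk_eq_zero N, Submodule.Quotient.mk_sub, sub_eq_zero]
        exact hzy.symm
      have := Submodule.add_mem_sup hz hyz
      rwa [add_sub_cancel] at this
  have h1 : Module.length A (Submodule.span A {x}) ≤
      Module.length A ((Submodule.span A {x}).map N.mkQ) := by
    refine Module.length_le_of_injective (N.mkQ.submoduleMap _) ?_
    rw [← LinearMap.ker_eq_bot, LinearMap.ker_eq_bot']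
    rintro ⟨z, hz⟩ h0
    have hzN : z ∈ N := (Submodule.Quotient.mk_eq_zero N).1 (congrArg Subtype.val h0)
    exact Subtype.ext (Submodule.disjoint_def.1 hN z hz hzN)
  have h2 : Module.length A ((Submodule.span A {y}).map N.mkQ) ≤
      Module.length A (Submodule.span A {y}) :=
    Module.length_le_of_surjective (N.mkQ.submoduleMap _) (N.mkQ.submoduleMap_surjective _)
  have h3 : Module.length A ((Submodule.span A {x}).map N.mkQ) <
      Module.length A ((Submodule.span A {y}).map N.mkQ) := by
    rw [Module.length_submodule, Module.length_submodule]
    exact Submodule.height_strictMono hlt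
  exact h1.trans_lt (h3.trans_le h2)

/-- A local submodule of maximal length over a Nakayama algebra has a complement. -/
theorem exists_isCompl_span_of_length_max [IsArtinianRing A] (hA : IsNakayama A)
    {M : Type u} [AddCommGroup M] [Module A M] [Module.Finite A M]
    {e : A} (he : IsPrimitiveIdempotent e) {x : M} (hex : e • x = x)
    (hmax : ∀ (f : A) (y : M), IsPrimitiveIdempotent f → f • y = y →
      ¬ Module.length A (Submodule.span A {x}) < Module.length A (Submodule.span A {y})) :
    ∃ N, IsCompl (Submodule.span A {x}) N := by
  obtain ⟨N, hN, hNmax⟩ := (wellFounded_gt (α := Submodule A M)).has_min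
    {N | Disjoint (Submodule.span A {x}) N} ⟨⊥, disjoint_bot_right⟩
  refine ⟨N, hN, codisjoint_iff.2 ?_⟩
  by_contra hW
  set W := Submodule.span A {x} ⊔ N with hWdef
  have hxW : x ∈ W := Submodule.mem_sup_left (Submodule.mem_span_singleton_self x)
  have hNW : N ≤ W := le_sup_right
  obtain ⟨f, y, hf, hfy, hyW, hJ⟩ := exists_primitive_minimal_over hW
  obtain ⟨g, c, hg, hgc, hcf, hcJ, hgen⟩ := exists_generator_jacobson_mul hA.1 hf
  obtain ⟨u, hu, n, hn, hun⟩ := Submodule.mem_sup.1 (hJ c hcJ)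
  obtain ⟨a, rfl⟩ := Submodule.mem_span_singleton.1 hu
  set d := g * a * e with hd
  have hgd : g * d = d := by rw [hd, ← mul_assoc, ← mul_assoc, hg.1.eq]
  have hde : d * e = d := by rw [hd, mul_assoc, he.1.eq]
  have hcy : c • y = d • x + g • n := by
    rw [hd, ← hgc, mul_smul, ← hun, smul_add, mul_smul, mul_smul, hex]
  have hgn : g • n ∈ N := N.smul_mem g hn
  -- If `s * d = e`, then `(s * c) • y` is `x` plus an element of `N`, so `Ay` would be longer than
  -- `Ax`.
  have hdJ : d ∈ Ring.jacobson A := by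
    by_contra hdJ
    obtain ⟨s, hs⟩ : ∃ s, s * d = e := by
      by_contra h
      exact hdJ (mem_jacobson_of_not_generator hA.1 he hde h)
    refine hmax f y hf hfy (length_span_singleton_lt hN hyW (N.smul_mem s hgn) ?_)
    refine Submodule.mem_span_singleton.2 ⟨s * c, ?_⟩
    rw [mul_smul, hcy, smul_add, ← mul_smul, hs, hex]
  -- Correct `y` by a multiple of `x` so that `c` sends it into `N`. Since `c • y` and `d • x` agree
  -- modulo `N`, `d = c * r` is enough. Uniseriality of `gA` leaves only the case that `c` is a
  -- right multiple of `d`.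
  obtain ⟨r, hr⟩ : ∃ r : A, c • (y - r • x) ∈ N := by
    have of_mul : (∃ r, d = c * r) → ∃ r : A, c • (y - r • x) ∈ N := by
      rintro ⟨r, hr⟩
      refine ⟨r, ?_⟩
      rw [smul_sub, ← mul_smul, ← hr, hcy, add_sub_cancel_left]
      exact hgn
    rcases right_chain hA.2 hg hgc hgd with ⟨s, hs⟩ | h
    swap
    · exact of_mul h
    set t := e * s * f with ht
    have htf : t * f = t := by rw [ht, mul_assoc, hf.1.eq]
    have het : e * t = t := by rw [ht, ← mul_assoc, ← mul_assoc, he.1.eq]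
    have hct : c = d * t := by
      rw [ht, ← mul_assoc, ← mul_assoc, hde, ← hs, hcf]
    -- If `t` generates `Af`, then `t * (f * w * e)` is a nonzero idempotent below `e`. It equals
    -- `e`, so `c = d * t` can be solved for `d`.
    by_cases h : ∃ w, w * t = f
    · obtain ⟨w, hw⟩ := h
      have hf2 : f * w * e * t = f := by
        rw [mul_assoc, het, mul_assoc, hw, hf.1.eq]
      have hidem : IsIdempotentElem (t * (f * w * e)) := by
        calc t * (f * w * e) * (t * (f * w * e)) = t * (f * w * e * t) * (f * w * e) := by
              noncomm_ring
          _ = t * (f * w * e) := by rw [hf2, htf]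
      rcases he.2.2 _ hidem (by rw [← mul_assoc, het])
        (by rw [mul_assoc, mul_assoc (f * w), he.1.eq]) with h0 | h1
      · exfalso
        apply hf.2.1
        calc f = f * w * e * t * (f * w * e * t) := by rw [hf2, hf.1.eq]
          _ = f * w * e * (t * (f * w * e)) * t := by noncomm_ring
          _ = 0 := by rw [h0, mul_zero, zero_mul]
      · apply of_mul
        exact ⟨f * w * e, by rw [hct, mul_assoc, h1, hde]⟩
    -- Otherwise `t = b * c`, so `c = (d * b) * c` with `d * b` in the radical, and `c` vanishes.
    · obtain ⟨b, hb⟩ := hgen t (mem_jacobson_of_not_generator hA.1 hf htf h) htf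
      have hc0 : c = 0 := by
        refine smul_eq_zero_of_mem_jacobson (j := d * b) (Ideal.mul_mem_right _ _ hdJ) ?_
        rw [smul_eq_mul, mul_assoc, ← hb, ← hct]
      exact ⟨0, by rw [hc0, zero_smul]; exact N.zero_mem⟩
  set y' := y - (f * r) • x with hy'
  have hfy' : f • y' = y' := by
    rw [hy', smul_sub, hfy, ← mul_smul, ← mul_assoc, hf.1.eq]
  have hcy' : c • y' ∈ N := by
    have : c • y' = c • (y - r • x) := by
      rw [hy', smul_sub, smul_sub, ← mul_smul, ← mul_smul, ← mul_assoc, hcf]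
    rwa [this]
  have hy'W : y' ∉ W := fun h => hyW (by
    have := W.add_mem h (W.smul_mem (f * r) hxW)
    rwa [hy', sub_add_cancel] at this)
  -- Adding `y'` to `N` keeps it disjoint from `Ax`. Let `p + b • y'` lie in `Ax`. If `b * f`
  -- generates `Af`, then `y' ∈ W`. Otherwise `b * f ∈ Ac`, so `b • y' ∈ N`.
  refine hNmax (N ⊔ Submodule.span A {y'}) ?_ ?_
  · rw [Set.mem_ofPred_eq, Submodule.disjoint_def]
    intro z hzx hz
    obtain ⟨p, hp, q, hq, rfl⟩ := Submodule.mem_sup.1 hz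
    obtain ⟨b, rfl⟩ := Submodule.mem_span_singleton.1 hq
    have hbf : b * f * f = b * f := by rw [mul_assoc, hf.1.eq]
    have hby : b • y' = (b * f) • y' := by rw [mul_smul, hfy']
    by_cases h : ∃ s, s * (b * f) = f
    · exfalso
      obtain ⟨s, hs⟩ := h
      apply hy'W
      have : y' = s • ((p + b • y') - p) := by
        rw [add_sub_cancel_left, hby, ← mul_smul, hs, hfy']
      rw [this]
      exact W.smul_mem _ (W.sub_mem (Submodule.mem_sup_left hzx) (hNW hp))
    · obtain ⟨k, hk⟩ := hgen _ (mem_jacobson_of_not_generator hA.1 hf hbf h) hbf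
      refine Submodule.disjoint_def.1 hN _ hzx (N.add_mem hp ?_)
      rw [hby, hk, mul_smul]
      exact N.smul_mem _ hcy'
  · refine lt_of_le_of_ne le_sup_left fun h => hy'W (hNW ?_)
    rw [h]
    exact Submodule.mem_sup_right (Submodule.mem_span_singleton_self y')

/-- A finitely generated indecomposable module over a Nakayama algebra is a quotient of the
indecomposable projective that belongs to some primitive idempotent. -/
theorem IsIndecomposable.exists_generator [IsArtinianRing A] (hA : IsNakayama A)
    {M : Type u} [AddCommGroup M] [Module A M] [Module.Finite A M] (hM : IsIndecomposable A M) :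
    ∃ (e : A) (x : M), IsPrimitiveIdempotent e ∧ e • x = x ∧ Submodule.span A {x} = ⊤ := by
  obtain ⟨hnt, hdec⟩ := hM
  obtain ⟨m, hm⟩ := exists_ne (0 : M)
  obtain ⟨g, hg, hgm, hggm⟩ := exists_primitive_smul_eq_of_not_mem (A := A) (W := ⊥) (m := m)
    (by simpa using hm)
  let ℓ : M → ℕ∞ := fun z => Module.length A (Submodule.span A {z})
  have hfin : Module.length A M ≠ ⊤ := Module.length_ne_top
  have hle : ∀ z, ℓ z ≤ Module.length A M := fun z =>
    Module.length_le_of_injective (Submodule.subtype _) (Submodule.subtype_injective _)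
  -- Minimising the length deficit, a natural number, maximises the length of `Ax`.
  obtain ⟨x, ⟨e, he, hex⟩, hmin⟩ :=
    (measure fun z : M => (Module.length A M).toNat - (ℓ z).toNat).wf.has_min
      {z | ∃ f : A, IsPrimitiveIdempotent f ∧ f • z = z} ⟨g • m, g, hg, hggm⟩
  have hmax : ∀ (f : A) (y : M), IsPrimitiveIdempotent f → f • y = y → ¬ ℓ x < ℓ y := by
    intro f y hf hfy hlt
    have h1 : (ℓ x).toNat < (ℓ y).toNat := by
      rwa [← Nat.cast_lt (α := ℕ∞), ENat.natCast_toNat (ne_top_of_le_ne_top hfin (hle x)),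
        ENat.natCast_toNat (ne_top_of_le_ne_top hfin (hle y))]
    have h2 : (ℓ y).toNat ≤ (Module.length A M).toNat := ENat.toNat_le_toNat (hle y) hfin
    exact hmin y ⟨f, hf, hfy⟩ (show (Module.length A M).toNat - (ℓ y).toNat <
      (Module.length A M).toNat - (ℓ x).toNat by omega)
  obtain ⟨N, hN⟩ := exists_isCompl_span_of_length_max hA he hex hmax
  refine ⟨e, x, he, hex, ?_⟩
  rcases hdec _ _ hN with h | h
  · exfalso
    apply hmax g (g • m) hg hggm
    have h0 : ℓ x = 0 := by
      simp only [ℓ]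
      rw [h, Module.length_bot]
    rw [h0]
    have : Nontrivial (Submodule.span A {g • m}) :=
      ⟨⟨g • m, Submodule.mem_span_singleton_self _⟩, 0, fun h => hgm (by
        simpa using congrArg Subtype.val h)⟩
    exact Module.length_pos
  · simpa [h] using hN.sup_eq_top

end Uniserial

end SimpleMinded

namespace SimpleMinded

/-! ### Uniserial modules: tops, socles and stable surjections -/

section Structure

variable {A : Type u} [Ring A]
variable {M N : Type u} [AddCommGroup M] [Module A M] [AddCommGroup N] [Module A N]

theorem IsUniserial.of_surjective (hM : IsUniserial A M) (f : M →ₗ[A] N)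
    (hf : Function.Surjective f) : IsUniserial A N := fun K L =>
  (hM (K.comap f) (L.comap f)).imp
    (fun h => (Submodule.comap_le_comap_iff_of_surjective hf).1 h)
    (fun h => (Submodule.comap_le_comap_iff_of_surjective hf).1 h)

theorem exists_surjective_of_smul_eq {e : A} {x : M} (hex : e • x = x)
    (hx : Submodule.span A {x} = ⊤) :
    ∃ f : Submodule.span A {e} →ₗ[A] M, Function.Surjective f := by
  refine ⟨(LinearMap.toSpanSingleton A M x).domRestrict _, fun m => ?_⟩
  obtain ⟨a, rfl⟩ := Submodule.mem_span_singleton.1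
    (hx ▸ Submodule.mem_top : m ∈ Submodule.span A {x})
  refine ⟨⟨a * e, Submodule.mem_span_singleton.2 ⟨a, rfl⟩⟩, ?_⟩
  simp [mul_smul, hex]

theorem IsPrimitiveIdempotent.isUniserial (hA : HasUniserialProjectives A) {e : A}
    (he : IsPrimitiveIdempotent e) : IsUniserial A (Submodule.span A {e}) :=
  hA _ inferInstance (span_singleton_idempotent_projective he.1) he.isIndecomposable

theorem exists_surjective_or_of_uniserial {P : Type u} [AddCommGroup P] [Module A P]
    (hP : IsUniserial A P) (α : P →ₗ[A] M) (hα : Function.Surjective α)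
    (β : P →ₗ[A] N) (hβ : Function.Surjective β) :
    (∃ f : M →ₗ[A] N, Function.Surjective f) ∨ ∃ f : N →ₗ[A] M, Function.Surjective f := by
  have key : ∀ {M N : Type u} [AddCommGroup M] [Module A M] [AddCommGroup N] [Module A N]
      (α : P →ₗ[A] M) (_ : Function.Surjective α) (β : P →ₗ[A] N) (_ : Function.Surjective β),
      LinearMap.ker α ≤ LinearMap.ker β → ∃ f : M →ₗ[A] N, Function.Surjective f := by
    intro M N _ _ _ _ α hα β hβ h
    refine ⟨(LinearMap.ker α).liftQ β h ∘ₗ (α.quotKerEquivOfSurjective hα).symm, ?_⟩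
    rw [LinearMap.coe_comp]
    refine Function.Surjective.comp (fun n => ?_) (LinearEquiv.surjective _)
    obtain ⟨p, rfl⟩ := hβ n
    exact ⟨Submodule.Quotient.mk p, rfl⟩
  exact (hP (LinearMap.ker α) (LinearMap.ker β)).imp (key α hα β hβ) (key β hβ α hα)

theorem IsUniserial.isCoatom_jacobson (hM : IsUniserial A M) [Module.Finite A M] [Nontrivial M] :
    IsCoatom (Module.jacobson A M) := by
  obtain ⟨K, hK, -⟩ := (eq_top_or_exists_le_coatom (⊥ : Submodule A M)).resolve_left bot_ne_top
  have : Module.jacobson A M = K := by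
    refine le_antisymm (sInf_le hK) (le_sInf fun L hL => ?_)
    rcases hM K L with h | h
    · exact h
    · rcases h.eq_or_lt with h | h
      · exact h.ge
      · exact absurd (hL.2 _ h) hK.1
  rwa [this]

theorem IsUniserial.le_jacobson (hM : IsUniserial A M) [Module.Finite A M] [Nontrivial M]
    {K : Submodule A M} (hK : K ≠ ⊤) : K ≤ Module.jacobson A M := by
  rcases hM K (Module.jacobson A M) with h | h
  · exact h
  · rcases h.eq_or_lt with h' | h'
    · exact h'.ge
    · exact absurd (hM.isCoatom_jacobson.2 _ h') hK

theorem IsUniserial.isAtom_socle (hM : IsUniserial A M) [IsArtinian A M] [Nontrivial M] :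
    IsAtom (socle A M) := by
  obtain ⟨K, hK, -⟩ := (eq_bot_or_exists_atom_le (⊤ : Submodule A M)).resolve_left top_ne_bot
  have : socle A M = K := by
    refine le_antisymm (sSup_le fun L hL => ?_) (le_sSup (isSimpleModule_iff_isAtom.2 hK))
    have hL : IsAtom L := isSimpleModule_iff_isAtom.1 hL
    rcases hM L K with h | h
    · exact h
    · rcases h.eq_or_lt with h | h
      · exact h.ge
      · exact absurd (hL.2 _ h) hK.1
  rwa [this]

/-- A nonzero homomorphism from a simple module to a uniserial module maps onto the socle. -/
theorem IsUniserial.socle_equiv_of_ne_zero (hM : IsUniserial A M) [IsArtinian A M] [Nontrivial M]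
    {T : Type u} [AddCommGroup T] [Module A T] [IsSimpleModule A T] {f : T →ₗ[A] M} (hf : f ≠ 0) :
    Nonempty (socle A M ≃ₗ[A] T) := by
  have e := LinearEquiv.ofInjective f (LinearMap.injective_of_ne_zero hf)
  have hs : IsSimpleModule A (LinearMap.range f) := IsSimpleModule.congr e.symm
  have hle : LinearMap.range f ≤ socle A M := le_sSup hs
  have : socle A M = LinearMap.range f :=
    ((hM.isAtom_socle.le_iff_eq (isSimpleModule_iff_isAtom.1 hs).1).1 hle).symm
  exact ⟨(LinearEquiv.ofEq _ _ this).trans e.symm⟩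

theorem IsIndecomposable.not_surjective_to_projective (hM : IsIndecomposable A M)
    (hMp : ¬ Module.Projective A M) {Q : Type u} [AddCommGroup Q] [Module A Q] [Nontrivial Q]
    [Module.Projective A Q] (f : M →ₗ[A] Q) : ¬ Function.Surjective f := by
  intro hf
  obtain ⟨s, hs⟩ := Module.projective_lifting_property f LinearMap.id hf
  have hfs : ∀ q, f (s q) = q := fun q => LinearMap.congr_fun hs q
  have hc : IsCompl (LinearMap.ker f) (LinearMap.range s) := by
    constructor
    · rw [Submodule.disjoint_def]
      rintro _ h ⟨q, rfl⟩
      rw [LinearMap.mem_ker, hfs] at h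
      rw [h, map_zero]
    · rw [codisjoint_iff, eq_top_iff]
      intro m _
      refine Submodule.mem_sup.2 ⟨m - s (f m), ?_, s (f m), ⟨_, rfl⟩, sub_add_cancel _ _⟩
      rw [LinearMap.mem_ker, map_sub, hfs, sub_self]
  rcases hM.2 _ _ hc with h | h
  · exact hMp (Module.Projective.of_equiv
      (LinearEquiv.ofBijective f ⟨LinearMap.ker_eq_bot.1 h, hf⟩).symm)
  · obtain ⟨q, hq⟩ := exists_ne (0 : Q)
    apply hq
    rw [← hfs q, LinearMap.range_eq_bot.1 h, LinearMap.zero_apply, map_zero]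

theorem IsIndecomposable.exists_uniserial_cover [IsArtinianRing A] (hA : IsNakayama A)
    [Module.Finite A M] (hM : IsIndecomposable A M) :
    ∃ (P : Submodule A A) (π : P →ₗ[A] M), Function.Surjective π ∧ Module.Projective A P ∧
      IsUniserial A P := by
  obtain ⟨e, x, he, hex, hx⟩ := hM.exists_generator hA
  obtain ⟨π, hπ⟩ := exists_surjective_of_smul_eq hex hx
  exact ⟨_, π, hπ, span_singleton_idempotent_projective he.1, he.isUniserial hA.1⟩

/-- Finitely generated indecomposable modules over Nakayama algebras are uniserial. -/
theorem IsIndecomposable.isUniserial [IsArtinianRing A] (hA : IsNakayama A)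
    [Module.Finite A M] (hM : IsIndecomposable A M) : IsUniserial A M := by
  obtain ⟨P, π, hπ, -, hP⟩ := hM.exists_uniserial_cover hA
  exact hP.of_surjective π hπ

theorem IsIndecomposable.isSimpleModule_top [IsArtinianRing A] (hA : IsNakayama A)
    [Module.Finite A M] (hM : IsIndecomposable A M) : IsSimpleModule A (Top A M) :=
  have := hM.1
  isSimpleModule_iff_isCoatom.2 (hM.isUniserial hA).isCoatom_jacobson

theorem IsIndecomposable.isSimpleModule_socle [IsArtinianRing A] (hA : IsNakayama A)
    [Module.Finite A M] (hM : IsIndecomposable A M) : IsSimpleModule A (socle A M) :=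
  have := hM.1
  isSimpleModule_iff_isAtom.2 (hM.isUniserial hA).isAtom_socle

theorem IsIndecomposable.not_projective_top [IsArtinianRing A] (hA : IsNakayama A)
    [Module.Finite A M] (hM : IsIndecomposable A M) (hMp : ¬ Module.Projective A M) :
    ¬ Module.Projective A (Top A M) := by
  intro h
  have := hM.isSimpleModule_top hA
  have := IsSimpleModule.nontrivial A (Top A M)
  exact hM.not_surjective_to_projective hMp _ (Submodule.mkQ_surjective (Module.jacobson A M))

theorem IsIndecomposable.not_projective_socle [IsArtinianRing A] (hA : IsNakayama A)
    [Module.Finite A M] (hM : IsIndecomposable A M) (hMp : ¬ Module.Projective A M) :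
    ¬ Module.Projective A (socle A M) := by
  intro h
  have := hM.isSimpleModule_socle hA
  have hnt := IsSimpleModule.nontrivial A (socle A M)
  obtain ⟨P, π, hπ, hPp, hP⟩ := hM.exists_uniserial_cover hA
  obtain ⟨l, hl⟩ := Module.projective_lifting_property π (socle A M).subtype hπ
  have hπl : ∀ z, π (l z) = z := fun z => LinearMap.congr_fun hl z
  -- `π` is injective on the range of `l`. So either `ker π` lies in that range and vanishes, which
  -- makes `M` projective, or the inclusion of the socle is zero.
  rcases hP (LinearMap.ker π) (LinearMap.range l) with h1 | h1
  · refine hMp (Module.Projective.of_equiv (LinearEquiv.ofBijective π ⟨?_, hπ⟩))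
    rw [← LinearMap.ker_eq_bot, eq_bot_iff]
    intro p hp
    obtain ⟨z, rfl⟩ := h1 hp
    have hz : (z : M) = 0 := by rw [← hπl, LinearMap.mem_ker.1 hp]
    rw [Submodule.mem_bot, show z = 0 from Subtype.ext hz, map_zero]
  · obtain ⟨z, hz⟩ := exists_ne (0 : socle A M)
    apply hz
    apply Subtype.ext
    rw [← hπl, LinearMap.mem_ker.1 (h1 ⟨z, rfl⟩)]
    rfl

/-- Surjections between indecomposable modules, the first of them not projective, are nonzero in
the stable category. -/
theorem IsIndecomposable.not_factors_of_surjective [IsArtinianRing A] (hA : IsNakayama A)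
    (hM : IsIndecomposable A M) (hMp : ¬ Module.Projective A M)
    [Module.Finite A N] (hN : IsIndecomposable A N) {f : M →ₗ[A] N} (hf : Function.Surjective f) :
    ¬ FactorsThroughProjective A f := by
  rintro ⟨Q, _, _, -, hQ, g, h, rfl⟩
  obtain ⟨P, π, hπ, hPp, hP⟩ := hN.exists_uniserial_cover hA
  obtain ⟨k, rfl⟩ := Module.projective_lifting_property π h hπ
  have hsurj : ∀ n, ∃ m, π (k (g m)) = n := hf
  have := hN.1
  have : Nontrivial P := hπ.nontrivial
  refine hM.not_surjective_to_projective hMp (k ∘ₗ g) ?_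
  rw [← LinearMap.range_eq_top, eq_top_iff]
  -- The image of `k ∘ₗ g` maps onto `N ≠ 0`, so it is not inside `ker π` and, by uniseriality of
  -- `P`, contains it. Hence `k ∘ₗ g` is onto the projective module `P`, which would split off `M`.
  have hker : LinearMap.ker π ≤ LinearMap.range (k ∘ₗ g) := by
    refine (hP _ _).resolve_right fun h1 => ?_
    obtain ⟨n, hn⟩ := exists_ne (0 : N)
    obtain ⟨m, hm⟩ := hsurj n
    exact hn (hm ▸ LinearMap.mem_ker.1 (h1 ⟨m, rfl⟩))
  intro p _
  obtain ⟨m, hm⟩ := hsurj (π p)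
  have hd : p - k (g m) ∈ LinearMap.ker π := by rw [LinearMap.mem_ker, map_sub, hm, sub_self]
  have := Submodule.add_mem _ (hker hd) ⟨m, rfl⟩
  simpa using this

/-- The image of a generator `x = e • x` of `M` in the top of `N` lifts to some `e • n`. It lies
outside the radical and so generates `N`. Both modules are then quotients of the uniserial `Ae`. -/
theorem exists_surjective_or_of_top_equiv [IsArtinianRing A] (hA : IsNakayama A)
    [Module.Finite A M] [Module.Finite A N] (hM : IsIndecomposable A M)
    (hN : IsIndecomposable A N) (φ : Top A M ≃ₗ[A] Top A N) :
    (∃ f : M →ₗ[A] N, Function.Surjective f) ∨ ∃ f : N →ₗ[A] M, Function.Surjective f := by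
  obtain ⟨e, x, he, hex, hx⟩ := hM.exists_generator hA
  have := hM.1
  have := hN.1
  obtain ⟨n, hn⟩ := Submodule.mkQ_surjective _ (φ (Submodule.Quotient.mk x))
  have hen : Submodule.Quotient.mk (p := Module.jacobson A N) (e • n) =
      φ (Submodule.Quotient.mk x) := by
    rw [Submodule.Quotient.mk_smul, ← Submodule.mkQ_apply, hn, ← map_smul,
      ← Submodule.Quotient.mk_smul, hex]
  have hspan : Submodule.span A {e • n} = ⊤ := by
    by_contra hne
    have h0 := (hN.isUniserial hA).le_jacobson hne (Submodule.mem_span_singleton_self _)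
    rw [← Submodule.Quotient.mk_eq_zero, hen, map_eq_zero_iff φ φ.injective,
      Submodule.Quotient.mk_eq_zero] at h0
    exact (hM.isUniserial hA).isCoatom_jacobson.1 (eq_top_iff.2
      (hx ▸ (Submodule.span_singleton_le_iff_mem _ _).2 h0))
  obtain ⟨α, hα⟩ := exists_surjective_of_smul_eq hex hx
  obtain ⟨β, hβ⟩ := exists_surjective_of_smul_eq
    (show e • (e • n) = e • n by rw [← mul_smul, he.1.eq]) hspan
  exact exists_surjective_or_of_uniserial (he.isUniserial hA.1) α hα β hβ

/-- A set of pairwise non-isomorphic simple modules is finite. -/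
theorem finite_of_simple [IsArtinianRing A] (hA : HasUniserialProjectives A)
    (𝒯 : Set (ModuleCat.{u} A)) (hs : ∀ T ∈ 𝒯, IsSimpleModule A T)
    (hiso : ∀ S ∈ 𝒯, ∀ T ∈ 𝒯, Nonempty (S ≃ₗ[A] T) → S = T) : 𝒯.Finite := by
  -- Finitely many primitive idempotents detect every nonzero module. A simple `T` with `g • T ≠ 0`
  -- is a quotient of the uniserial `Ag`, which has only one simple quotient up to isomorphism.
  obtain ⟨G, hG, h1⟩ := Submodule.mem_span_finite_of_mem_span (one_mem_span_primitive (A := A))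
  have hex : ∀ T : 𝒯, ∃ g : G, ∃ t : (T : ModuleCat.{u} A), (g : A) • t ≠ 0 := by
    intro T
    by_contra hc
    push Not at hc
    have := hs T T.2
    have := IsSimpleModule.nontrivial A (T : ModuleCat.{u} A)
    obtain ⟨t, ht⟩ := exists_ne (0 : (T : ModuleCat.{u} A))
    have hle : Submodule.span A (G : Set A) ≤ LinearMap.ker (LinearMap.toSpanSingleton A _ t) :=
      Submodule.span_le.2 fun g hg => hc ⟨g, hg⟩ t
    apply ht
    simpa using hle h1
  choose γ hγ using hex
  have hcover : ∀ T : 𝒯, ∃ f : Submodule.span A {(γ T : A)} →ₗ[A] (T : ModuleCat.{u} A),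
      Function.Surjective f := by
    intro T
    obtain ⟨t, ht⟩ := hγ T
    have := hs T T.2
    have hid : IsIdempotentElem (γ T : A) := (hG (γ T).2).1
    refine exists_surjective_of_smul_eq (x := (γ T : A) • t)
      (by rw [← mul_smul, hid.eq]) ?_
    exact IsSimpleModule.span_singleton_eq_top A ht
  have hinj : Function.Injective γ := by
    intro S T h
    obtain ⟨α, hα⟩ := hcover S
    obtain ⟨β, hβ⟩ : ∃ f : Submodule.span A {(γ S : A)} →ₗ[A] (T : ModuleCat.{u} A),
        Function.Surjective f := h ▸ hcover T
    have := hs S S.2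
    have := hs T T.2
    have key : ∀ {S T : ModuleCat.{u} A} [IsSimpleModule A S] [IsSimpleModule A T]
        (f : S →ₗ[A] T), Function.Surjective f → Nonempty (S ≃ₗ[A] T) := by
      intro S T _ _ f hf
      refine ⟨LinearEquiv.ofBijective f (LinearMap.bijective_of_ne_zero ?_)⟩
      rintro rfl
      have := IsSimpleModule.nontrivial A T
      obtain ⟨t, ht⟩ := exists_ne (0 : T)
      obtain ⟨s, hs⟩ := hf t
      exact ht hs.symm
    apply Subtype.ext
    rcases exists_surjective_or_of_uniserial ((hG (γ S).2 : IsPrimitiveIdempotent _).isUniserial hA)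
      α hα β hβ with ⟨f, hf⟩ | ⟨f, hf⟩
    · exact hiso _ S.2 _ T.2 (key f hf)
    · exact (hiso _ T.2 _ S.2 (key f hf)).symm
  exact Set.finite_coe_iff.1 (Finite.of_injective γ hinj)

end Structure

end SimpleMinded

namespace SimpleMinded

/-! ### Stably zero homomorphisms -/

section StableCategory

variable {A : Type u} [Ring A]

theorem FactorsThroughProjective.comp_left {X Y Z : Type u} [AddCommGroup X] [Module A X]
    [AddCommGroup Y] [Module A Y] [AddCommGroup Z] [Module A Z] {f : X →ₗ[A] Y}
    (hf : FactorsThroughProjective A f) (h : Y →ₗ[A] Z) :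
    FactorsThroughProjective A (h ∘ₗ f) := by
  obtain ⟨P, _, _, hP, hP', g, k, rfl⟩ := hf
  exact ⟨P, inferInstance, inferInstance, hP, hP', g, h ∘ₗ k, rfl⟩

theorem projective_of_factors_retract {X Y : Type u} [AddCommGroup X] [Module A X]
    [AddCommGroup Y] [Module A Y] {f : X →ₗ[A] Y} (hf : FactorsThroughProjective A f)
    (i : Y →ₗ[A] X) (h : f ∘ₗ i = LinearMap.id) : Module.Projective A Y := by
  obtain ⟨P, _, _, hP, hP', g, k, rfl⟩ := hf
  exact Module.Projective.of_split (g ∘ₗ i) k h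

theorem factorsThroughProjective_of_subsingleton_stableHom {X Y : Type u} [AddCommGroup X]
    [Module A X] [AddCommGroup Y] [Module A Y] (h : Subsingleton (StableHom A X Y))
    (f : X →ₗ[A] Y) : FactorsThroughProjective A f :=
  (QuotientAddGroup.eq_zero_iff (N := projHoms A X Y) f).1 (h.elim _ _)

theorem mk_stableEnd_eq_zero_iff {M : Type u} [AddCommGroup M] [Module A M]
    (f : Module.End A M) : (projEnds A M).ringCon.mk' f = 0 ↔ FactorsThroughProjective A f := by
  rw [← TwoSidedIdeal.mem_ker, TwoSidedIdeal.ker_ringCon_mk', projEnds, TwoSidedIdeal.mem_mk']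
  rfl

/-- A module without projective direct summands whose stable endomorphism ring is a division ring
is indecomposable. -/
theorem isIndecomposable_of_isDivision {M : Type u} [AddCommGroup M] [Module A M]
    (hM : HasNoProjectiveSummand A M) (hd : IsDivision (StableEnd A M)) : IsIndecomposable A M := by
  obtain ⟨hnt, hu⟩ := hd
  constructor
  · by_contra hn
    rw [not_nontrivial_iff_subsingleton] at hn
    have h1 : (projEnds A M).ringCon.mk' 1 = 0 := by
      rw [mk_stableEnd_eq_zero_iff]
      exact Subsingleton.elim (0 : M →ₗ[A] M) 1 ▸ FactorsThroughProjective.zero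
    rw [map_one] at h1
    exact one_ne_zero h1
  · intro N N' hN
    have key : ∀ (K K' : Submodule A M) (h : IsCompl K K'),
        FactorsThroughProjective A (K.projection K' h) → K = ⊥ := by
      intro K K' h hf
      refine hM K K' h (projective_of_factors_retract
        (hf.comp_left (K.projectionOnto K' h)) K.subtype ?_)
      ext x
      simp
    -- The complementary projections multiply to zero in a division ring, so one is stably zero. Its
    -- image is then projective, hence zero.
    have hmul : (projEnds A M).ringCon.mk' (N.projection N' hN) *
        (projEnds A M).ringCon.mk' (N'.projection N hN.symm) = 0 := by
      have h0 : N.projection N' hN * N'.projection N hN.symm = 0 := by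
        ext x
        simp
      rw [← map_mul, h0, map_zero]
    by_cases h0 : (projEnds A M).ringCon.mk' (N.projection N' hN) = 0
    · exact Or.inl (key N N' hN ((mk_stableEnd_eq_zero_iff _).1 h0))
    · rw [(hu _ h0).mul_right_eq_zero] at hmul
      exact Or.inr (key N' N hN.symm ((mk_stableEnd_eq_zero_iff _).1 hmul))

variable {T : Type u} [AddCommGroup T] [Module A T]

theorem factors_of_mem_addClosure {C : Set (ModuleCat.{u} A)}
    (hC : ∀ X ∈ C, ∀ f : T →ₗ[A] X, FactorsThroughProjective A f) :
    ∀ X ∈ addClosure C, ∀ f : T →ₗ[A] X, FactorsThroughProjective A f := by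
  rintro X ⟨n, Y, hY, s, r, hrs⟩ f
  have hsum : r ∘ₗ ∑ i, LinearMap.single A (fun i => Y i) i ∘ₗ (LinearMap.proj i ∘ₗ s ∘ₗ f) =
      f := by
    have : ∑ i, LinearMap.single A (fun i => Y i) i ∘ₗ (LinearMap.proj i ∘ₗ s ∘ₗ f) =
        s ∘ₗ f := by
      ext t j
      simp [LinearMap.sum_apply, Finset.sum_apply, Finset.sum_pi_single]
    rw [this, ← LinearMap.comp_assoc, hrs, LinearMap.id_comp]
  rw [← hsum]
  refine FactorsThroughProjective.comp_left ?_ r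
  exact (projHoms A T (∀ i, Y i)).sum_mem fun i _ => (hC _ (hY i) _).comp_left _

/-- The composite of `f` to `Z` factors through a projective `Q`, and `Q → Z` lifts to `Y × P`.
Subtracting the lifted map leaves a homomorphism into `X`, which is stably zero. -/
theorem factors_of_mem_extensions {C D : Set (ModuleCat.{u} A)}
    (hC : ∀ X ∈ C, ∀ f : T →ₗ[A] X, FactorsThroughProjective A f)
    (hD : ∀ X ∈ D, ∀ f : T →ₗ[A] X, FactorsThroughProjective A f) :
    ∀ X ∈ extensions C D, ∀ f : T →ₗ[A] X, FactorsThroughProjective A f := by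
  rintro Y ⟨-, -, X, hX, Z, hZ, P, -, i, p, hi, hex, hp⟩ f
  have hCP : ∀ X ∈ C ∪ projectives A, ∀ f : T →ₗ[A] X, FactorsThroughProjective A f := by
    rintro X (hX | ⟨h1, h2⟩) f
    · exact hC X hX f
    · exact ⟨X, inferInstance, inferInstance, h1, h2, f, LinearMap.id, rfl⟩
  obtain ⟨Q, _, _, hQ, hQ', k, h, hkh⟩ := factors_of_mem_addClosure hD Z hZ
    (p ∘ₗ LinearMap.inl A Y P ∘ₗ f)
  obtain ⟨h', rfl⟩ := Module.projective_lifting_property p h hp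
  have hmem : ∀ t, (LinearMap.inl A Y P ∘ₗ f - h' ∘ₗ k) t ∈ LinearMap.range i := by
    intro t
    refine (hex _).1 ?_
    rw [LinearMap.sub_apply, map_sub, sub_eq_zero]
    exact LinearMap.congr_fun hkh t
  let l : T →ₗ[A] X := (LinearEquiv.ofInjective i hi).symm ∘ₗ LinearMap.codRestrict _ _ hmem
  have hl : i ∘ₗ l = LinearMap.inl A Y P ∘ₗ f - h' ∘ₗ k := by
    ext1 t
    exact congrArg Subtype.val ((LinearEquiv.ofInjective i hi).apply_symm_apply ⟨_, hmem t⟩)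
  have hf : f = LinearMap.fst A Y P ∘ₗ (i ∘ₗ l + h' ∘ₗ k) := by
    rw [hl, sub_add_cancel, ← LinearMap.comp_assoc, LinearMap.fst_comp_inl, LinearMap.id_comp]
  rw [hf]
  refine FactorsThroughProjective.comp_left (FactorsThroughProjective.add ?_ ?_) _
  · exact (factors_of_mem_addClosure hCP X hX l).comp_left i
  · exact ⟨Q, inferInstance, inferInstance, hQ, hQ', k, h', rfl⟩

theorem factors_of_mem_generated {C : Set (ModuleCat.{u} A)}
    (hC : ∀ X ∈ C, ∀ f : T →ₗ[A] X, FactorsThroughProjective A f) (n : ℕ) :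
    ∀ X ∈ generated C n, ∀ f : T →ₗ[A] X, FactorsThroughProjective A f := by
  induction n with
  | zero => exact factors_of_mem_addClosure hC
  | succ n ih => exact factors_of_mem_addClosure (factors_of_mem_extensions ih hC)

end StableCategory

/-! ### Tops and socles in a simple-minded system -/

section Systems

variable {A : Type u} [Ring A] {𝒮 : Set (ModuleCat.{u} A)}

theorem IsSimpleMindedSystem.isIndecomposable (h𝒮 : IsSimpleMindedSystem 𝒮)
    {M : ModuleCat.{u} A} (hM : M ∈ 𝒮) : IsIndecomposable A M :=
  isIndecomposable_of_isDivision (h𝒮.noProjectiveSummand M hM) (h𝒮.division M hM)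

theorem IsSimpleMindedSystem.not_projective (h𝒮 : IsSimpleMindedSystem 𝒮)
    {M : ModuleCat.{u} A} (hM : M ∈ 𝒮) : ¬ Module.Projective A M := by
  intro h
  have := (h𝒮.isIndecomposable hM).1
  exact top_ne_bot (h𝒮.noProjectiveSummand M hM ⊤ ⊥ isCompl_top_bot
    (Module.Projective.of_equiv Submodule.topEquiv.symm))

/-- Isomorphic tops force a surjection one way or the other. It is stably nonzero, against
orthogonality of distinct members. -/
theorem IsSimpleMindedSystem.eq_of_top_equiv [IsArtinianRing A] (hA : IsNakayama A)
    (h𝒮 : IsSimpleMindedSystem 𝒮) {M N : ModuleCat.{u} A} (hM : M ∈ 𝒮) (hN : N ∈ 𝒮)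
    (φ : Top A M ≃ₗ[A] Top A N) : M = N := by
  have := h𝒮.finite M hM
  have := h𝒮.finite N hN
  have hMi := h𝒮.isIndecomposable hM
  have hNi := h𝒮.isIndecomposable hN
  by_contra hne
  rcases exists_surjective_or_of_top_equiv hA hMi hNi φ with ⟨f, hf⟩ | ⟨f, hf⟩
  · exact hMi.not_factors_of_surjective hA (h𝒮.not_projective hM) hNi hf
      (factorsThroughProjective_of_subsingleton_stableHom (h𝒮.orthogonal M hM N hN hne) f)
  · exact hNi.not_factors_of_surjective hA (h𝒮.not_projective hN) hMi hf
      (factorsThroughProjective_of_subsingleton_stableHom (h𝒮.orthogonal N hN M hM (Ne.symm hne)) f)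

/-- The only use of the generating condition: if `T` had only stably zero homomorphisms to `𝒮`, its
own identity would be stably zero. -/
theorem IsSimpleMindedSystem.exists_socle_equiv [IsArtinianRing A] (hA : IsNakayama A)
    (h𝒮 : IsSimpleMindedSystem 𝒮) (T : ModuleCat.{u} A) [IsSimpleModule A T]
    (hT : ¬ Module.Projective A T) : ∃ M ∈ 𝒮, Nonempty (socle A M ≃ₗ[A] T) := by
  have hTi : IsIndecomposable A T := ⟨IsSimpleModule.nontrivial A T, fun N _ hN =>
    (eq_bot_or_eq_top N).imp_right fun h => by simpa [h] using hN.inf_eq_bot⟩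
  obtain ⟨n, hn⟩ := h𝒮.generating T inferInstance hTi hT
  obtain ⟨M, hM, f, hf⟩ : ∃ M ∈ 𝒮, ∃ f : T →ₗ[A] M, ¬ FactorsThroughProjective A f := by
    by_contra hc
    push Not at hc
    exact hT (projective_of_factors_retract
      (factors_of_mem_generated hc n T hn LinearMap.id) LinearMap.id rfl)
  have := h𝒮.finite M hM
  have := (h𝒮.isIndecomposable hM).1
  refine ⟨M, hM, ((h𝒮.isIndecomposable hM).isUniserial hA).socle_equiv_of_ne_zero (f := f) ?_⟩
  rintro rfl
  exact hf FactorsThroughProjective.zero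

end Systems

end SimpleMinded

theorem proposition6p2 {R : Type*} [CommRing R] [IsArtinianRing R]
    {A : Type u} [Ring A] [Algebra R A] [Module.Finite R A]
    (hA : SimpleMinded.IsNakayama A)
    (𝒮 : Set (ModuleCat.{u} A)) (h𝒮 : SimpleMinded.IsSimpleMindedSystem 𝒮)
    (𝒯 : Set (ModuleCat.{u} A))
    (h𝒯 : SimpleMinded.IsCompleteSetOfNonprojectiveSimples 𝒯) :
    𝒮.Finite ∧ 𝒮.encard = 𝒯.encard ∧
      (∃ σ : 𝒮 ≃ 𝒯, ∀ M : 𝒮,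
        Nonempty (SimpleMinded.Top A (M : ModuleCat.{u} A) ≃ₗ[A] (σ M : ModuleCat.{u} A))) ∧
      (∃ ρ : 𝒮 ≃ 𝒯, ∀ M : 𝒮,
        Nonempty (SimpleMinded.socle A (M : ModuleCat.{u} A) ≃ₗ[A]
          (ρ M : ModuleCat.{u} A))) := by
  have : IsArtinianRing A := IsArtinianRing.of_finite R A
  have : Finite 𝒯 := SimpleMinded.finite_of_simple hA.1 𝒯 h𝒯.simple h𝒯.nonisomorphic
  have hfin : ∀ M : 𝒮, Module.Finite A (M : ModuleCat.{u} A) := fun M => h𝒮.finite M M.2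
  have hind := fun M : 𝒮 => h𝒮.isIndecomposable M.2
  have hnp := fun M : 𝒮 => h𝒮.not_projective M.2
  have htop : ∀ M : 𝒮, ∃ T : 𝒯,
      Nonempty (SimpleMinded.Top A (M : ModuleCat.{u} A) ≃ₗ[A] (T : ModuleCat.{u} A)) := fun M => by
    obtain ⟨T, hT, φ⟩ := h𝒯.complete (ModuleCat.of A (SimpleMinded.Top A (M : ModuleCat.{u} A)))
      ((hind M).isSimpleModule_top hA) ((hind M).not_projective_top hA (hnp M))
    exact ⟨⟨T, hT⟩, φ⟩
  have hsoc : ∀ M : 𝒮, ∃ T : 𝒯,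
      Nonempty (SimpleMinded.socle A (M : ModuleCat.{u} A) ≃ₗ[A] (T : ModuleCat.{u} A)) :=
    fun M => by
      obtain ⟨T, hT, φ⟩ := h𝒯.complete
        (ModuleCat.of A (SimpleMinded.socle A (M : ModuleCat.{u} A)))
        ((hind M).isSimpleModule_socle hA) ((hind M).not_projective_socle hA (hnp M))
      exact ⟨⟨T, hT⟩, φ⟩
  choose σ hσ using htop
  choose ρ hρ using hsoc
  have hσinj : Function.Injective σ := fun M N h => by
    obtain ⟨φ⟩ := hσ M
    obtain ⟨ψ⟩ := hσ N
    rw [← h] at ψ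
    exact Subtype.ext (h𝒮.eq_of_top_equiv hA M.2 N.2 (φ.trans ψ.symm))
  have hρsurj : Function.Surjective ρ := fun T => by
    have := h𝒯.simple T T.2
    obtain ⟨M, hM, ⟨φ⟩⟩ := h𝒮.exists_socle_equiv hA T (h𝒯.nonprojective T T.2)
    obtain ⟨ψ⟩ := hρ ⟨M, hM⟩
    exact ⟨⟨M, hM⟩, Subtype.ext
      (h𝒯.nonisomorphic _ (ρ ⟨M, hM⟩).2 _ T.2 ⟨ψ.symm.trans φ⟩)⟩
  have : Finite 𝒮 := Finite.of_injective σ hσinj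
  -- Tops give one inequality and socles the other. Equality then makes the injection `σ` and the
  -- surjection `ρ` bijective.
  have hcard : Nat.card 𝒮 = Nat.card 𝒯 :=
    le_antisymm (Nat.card_le_card_of_injective σ hσinj) (Nat.card_le_card_of_surjective ρ hρsurj)
  have hσ' := (Nat.bijective_iff_injective_and_card σ).2 ⟨hσinj, hcard⟩
  have hρ' := (Nat.bijective_iff_surjective_and_card ρ).2 ⟨hρsurj, hcard⟩
  exact ⟨Set.toFinite 𝒮, Set.encard_congr (Equiv.ofBijective σ hσ'),
    ⟨Equiv.ofBijective σ hσ', hσ⟩, ⟨Equiv.ofBijective ρ hρ', hρ⟩⟩
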